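/- Let $\mathcal{E}$ be an exact category in the sense of Quillen: an additive category with a class of kernel--cokernel pairs $0\to X\xrightarrow{i}Y\xrightarrow{d}Z\to 0$, called conflations, closed under isomorphism, such that (calling $i$ an inflation and $d$ a deflation) identities are inflations and deflations, inflations and deflations are closed under composition, pushouts of inflations along arbitrary morphisms exist and are inflations, and pullbacks of deflations along arbitrary morphisms exist and are deflations. Assume that $\mathcal{E}$ is weakly idempotent complete, i.e. every section in $\mathcal{E}$ has a cokernel. A weak factorization system $(\mathcal{L},\mathcal{R})$ in $\mathcal{E}$ is called exact if, for every morphism $f$, one has $f\in\mathcal{L}$ if and only if $f$ is an inflation and $0\to\operatorname{Coker}f$ is in $\mathcal{L}$, and $f\in\mathcal{R}$ if and only if $f$ is a deflation and $\operatorname{Ker}f\to 0$ is in $\mathcal{R}$. An exact model structure on $\mathcal{E}$ is a triple $(\mathrm{Cof},\mathrm{W},\mathrm{Fib})$ of classes of morphisms such that $\mathrm{W}$ is closed under retracts and has the 2-out-of-3 property for composition, and $(\mathrm{Cof},\mathrm{W}\cap\mathrm{Fib})$ and $(\mathrm{Cof}\cap\mathrm{W},\mathrm{Fib})$ are exact weak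 factorization systems. A complete cotorsion pair is a pair $(\mathcal{A},\mathcal{B})$ of classes of objects such that $\mathcal{A}=\{A\mid \operatorname{Ext}^1_{\mathcal{E}}(A,B)=0\text{ for all }B\in\mathcal{B}\}$ and $\mathcal{B}=\{B\mid \operatorname{Ext}^1_{\mathcal{E}}(A,B)=0\text{ for all }A\in\mathcal{A}\}$ (Yoneda $\operatorname{Ext}$), and such that every $X\in\mathcal{E}$ admits conflations $0\to X\to B_X\to A_X\to 0$ and $0\to B^X\to A^X\to X\to 0$ with $A_X,A^X\in\mathcal{A}$ and $B_X,B^X\in\mathcal{B}$. Then there is a bijective correspondence between exact model structures on $\mathcal{E}$ and triples $(\mathcal{C},\mathcal{W},\mathcal{F})$ of classes of objects of $\mathcal{E}$ such that 1. $\mathcal{W}$ is closed under retracts, and if two of the three terms $X,Y,Z$ of a conflation $0\to X\to Y\to Z\to 0$ are in $\mathcal{W}$, then so is the third; 2. $(\mathcal{C},\mathcal{W}\cap\mathcal{F})$ and $(\mathcal{C}\cap\mathcal{W},\mathcal{F})$ are complete cotorsion pairs in $\mathcal{E}$. The correspondence assigns to $(\mathcal{C},\mathcal{W},\mathcal{F})$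 the exact model structure $(\mathrm{Cof},\mathrm{W},\mathrm{Fib})$ such that (a) $c\in\mathrm{Cof}$ if and only if $c$ is an inflation with cokernel in $\mathcal{C}$; (b) $w\in\mathrm{W}$ if and only if $w=w_dw_i$ for an inflation $w_i$ with cokernel in $\mathcal{W}$ and a deflation $w_d$ with kernel in $\mathcal{W}$; (c) $f\in\mathrm{Fib}$ if and only if $f$ is a deflation with kernel in $\mathcal{F}$. The inverse assigns to $(\mathrm{Cof},\mathrm{W},\mathrm{Fib})$ the triple $(\mathcal{C},\mathcal{W},\mathcal{F})$ in which $\mathcal{C}$ is the class of cofibrant objects ($0\to X$ in $\mathrm{Cof}$), $\mathcal{W}$ is the class of trivial objects ($0\to X$ in $\mathrm{W}$), and $\mathcal{F}$ is the class of fibrant objects ($X\to 0$ in $\mathrm{Fib}$). -/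

import Mathlib

open CategoryTheory CategoryTheory.Limits
open scoped ZeroObject

universe v u

/-- A category is weakly idempotent complete if every section has a cokernel. -/
def WeaklyIdempotentComplete (E : Type u) [Category.{v} E] [Preadditive E] : Prop :=
  ∀ ⦃X Y : E⦄ (s : X ⟶ Y), IsSplitMono s → HasCokernel s

section Inflations

variable {E : Type u} [Category.{v} E] [Preadditive E]

/-- Given a class of short sequences `X ⟶ Y ⟶ Z`, the morphisms occurring as the first map
of a sequence whose third term lies in `A`. -/
def firstMaps (conf : ObjectProperty (ShortComplex E)) (A : ObjectProperty E) :
    MorphismProperty E :=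
  fun _ _ i => ∃ (Z : E) (p : _ ⟶ Z) (w : i ≫ p = 0), conf (ShortComplex.mk i p w) ∧ A Z

/-- Given a class of short sequences `X ⟶ Y ⟶ Z`, the morphisms occurring as the second map
of a sequence whose first term lies in `B`. -/
def secondMaps (conf : ObjectProperty (ShortComplex E)) (B : ObjectProperty E) :
    MorphismProperty E :=
  fun _ _ p => ∃ (K : E) (i : K ⟶ _) (w : i ≫ p = 0), conf (ShortComplex.mk i p w) ∧ B K

end Inflations

/-- A Quillen exact structure on an additive category: a class of kernel-cokernel pairs
(the conflations), closed under isomorphism, such that identities are inflations and deflations,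
inflations and deflations are closed under composition, pushouts of inflations along arbitrary
morphisms exist and are inflations, and pullbacks of deflations along arbitrary morphisms exist
and are deflations. -/
structure ExactStructure (E : Type u) [Category.{v} E] [Preadditive E] [HasZeroObject E]
    [HasBinaryBiproducts E] where
  conflation : ObjectProperty (ShortComplex E)
  isClosedUnderIsomorphisms : conflation.IsClosedUnderIsomorphisms
  isKernel : ∀ S : ShortComplex E, conflation S → Nonempty (IsLimit (KernelFork.ofι S.f S.zero))
  isCokernel : ∀ S : ShortComplex E, conflation S →
    Nonempty (IsColimit (CokernelCofork.ofπ S.g S.zero))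
  inflation_id : ∀ X : E, firstMaps conflation ⊤ (𝟙 X)
  deflation_id : ∀ X : E, secondMaps conflation ⊤ (𝟙 X)
  inflation_comp : ∀ {X Y Z : E} (f : X ⟶ Y) (g : Y ⟶ Z),
    firstMaps conflation ⊤ f → firstMaps conflation ⊤ g → firstMaps conflation ⊤ (f ≫ g)
  deflation_comp : ∀ {X Y Z : E} (f : X ⟶ Y) (g : Y ⟶ Z),
    secondMaps conflation ⊤ f → secondMaps conflation ⊤ g → secondMaps conflation ⊤ (f ≫ g)
  inflation_pushout : ∀ {X Y X' : E} (i : X ⟶ Y) (f : X ⟶ X'), firstMaps conflation ⊤ i →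
    ∃ (Y' : E) (f' : Y ⟶ Y') (i' : X' ⟶ Y'), IsPushout i f f' i' ∧ firstMaps conflation ⊤ i'
  deflation_pullback : ∀ {Y Z Z' : E} (p : Y ⟶ Z) (g : Z' ⟶ Z), secondMaps conflation ⊤ p →
    ∃ (Y' : E) (g' : Y' ⟶ Y) (p' : Y' ⟶ Z'), IsPullback g' p' p g ∧ secondMaps conflation ⊤ p'

namespace ExactStructure

variable {E : Type u} [Category.{v} E] [Preadditive E] [HasZeroObject E] [HasBinaryBiproducts E]
  (X : ExactStructure E)

/-- The inflations with cokernel in `A`. -/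
def Infl (A : ObjectProperty E) : MorphismProperty E := firstMaps X.conflation A

/-- The deflations with kernel in `B`. -/
def Defl (B : ObjectProperty E) : MorphismProperty E := secondMaps X.conflation B

/-- A one-step extension of `A` by `B`: a conflation `0 ⟶ B ⟶ M ⟶ A ⟶ 0`. -/
structure Extension (A B : E) where
  M : E
  i : B ⟶ M
  p : M ⟶ A
  zero : i ≫ p = 0
  conflation : X.conflation (ShortComplex.mk i p zero)

/-- The Yoneda `Ext¹(A, B)`: extensions of `A` by `B` modulo the equivalence relation generated
by morphisms of extensions that are the identity on `A` and on `B`. -/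
def YonedaExt (A B : E) : Type (max u v) :=
  Quot (fun ε ε' : X.Extension A B => ∃ h : ε.M ⟶ ε'.M, ε.i ≫ h = ε'.i ∧ h ≫ ε'.p = ε.p)

/-- The class of objects `B` with `Ext¹(A, B) = 0` for all `A` in `S`. -/
def rightPerp (S : ObjectProperty E) : ObjectProperty E :=
  fun B => ∀ A, S A → Subsingleton (X.YonedaExt A B)

/-- The class of objects `A` with `Ext¹(A, B) = 0` for all `B` in `S`. -/
def leftPerp (S : ObjectProperty E) : ObjectProperty E :=
  fun A => ∀ B, S B → Subsingleton (X.YonedaExt A B)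

/-- Complete cotorsion pairs. -/
structure IsCompleteCotorsionPair (A B : ObjectProperty E) : Prop where
  left_eq : A = X.leftPerp B
  right_eq : X.rightPerp A = B
  /-- Every object `Y` has a conflation `0 ⟶ Y ⟶ B' ⟶ A' ⟶ 0`. -/
  exists_left_approx : ∀ Y : E, ∃ (B' A' : E) (i : Y ⟶ B') (p : B' ⟶ A') (w : i ≫ p = 0),
    X.conflation (ShortComplex.mk i p w) ∧ B B' ∧ A A'
  /-- Every object `Y` has a conflation `0 ⟶ B' ⟶ A' ⟶ Y ⟶ 0`. -/
  exists_right_approx : ∀ Y : E, ∃ (B' A' : E) (i : B' ⟶ A') (p : A' ⟶ Y) (w : i ≫ p = 0),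
    X.conflation (ShortComplex.mk i p w) ∧ B B' ∧ A A'

/-- The objects `A` such that `0 ⟶ A` belongs to `L`. -/
def fromZero (L : MorphismProperty E) : ObjectProperty E := fun A => L (0 : (0 : E) ⟶ A)

/-- The objects `B` such that `B ⟶ 0` belongs to `R`. -/
def toZero (R : MorphismProperty E) : ObjectProperty E := fun B => R (0 : B ⟶ (0 : E))

/-- Exact weak factorization systems: `f` is in `L` iff it is an inflation and `0 ⟶ Coker f` is
in `L`; `f` is in `R` iff it is a deflation and `Ker f ⟶ 0` is in `R`. -/
structure IsExactWFS (L R : MorphismProperty E) : Prop where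
  isWeakFactorizationSystem : L.IsWeakFactorizationSystem R
  mem_left_iff : ∀ {Y Z : E} (f : Y ⟶ Z), L f ↔ X.Infl (fromZero L) f
  mem_right_iff : ∀ {Y Z : E} (f : Y ⟶ Z), R f ↔ X.Defl (toZero R) f

/-- Exact model structures on the exact category `(E, X)`. -/
structure ExactModelStructure where
  cof : MorphismProperty E
  weq : MorphismProperty E
  fib : MorphismProperty E
  weq_isStableUnderRetracts : weq.IsStableUnderRetracts
  weq_hasTwoOutOfThreeProperty : weq.HasTwoOutOfThreeProperty
  isExactWFS_cof_trivialFib : X.IsExactWFS cof (weq ⊓ fib)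
  isExactWFS_trivialCof_fib : X.IsExactWFS (cof ⊓ weq) fib

/-- The 2-out-of-3 property for conflations. -/
structure HasTwoOutOfThree (W : ObjectProperty E) : Prop where
  left : ∀ S : ShortComplex E, X.conflation S → W S.X₂ → W S.X₃ → W S.X₁
  middle : ∀ S : ShortComplex E, X.conflation S → W S.X₁ → W S.X₃ → W S.X₂
  right : ∀ S : ShortComplex E, X.conflation S → W S.X₁ → W S.X₂ → W S.X₃

/-- Triples `(C, W, F)` of classes of objects such that `W` is closed under retracts and has the
2-out-of-3 property for conflations, and `(C, W ∩ F)` and `(C ∩ W, F)` are complete cotorsion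
pairs. -/
structure HoveyTriple where
  C : ObjectProperty E
  W : ObjectProperty E
  F : ObjectProperty E
  isStableUnderRetracts : W.IsStableUnderRetracts
  hasTwoOutOfThree : X.HasTwoOutOfThree W
  isCompleteCotorsionPair_cof : X.IsCompleteCotorsionPair C (W ⊓ F)
  isCompleteCotorsionPair_fib : X.IsCompleteCotorsionPair (C ⊓ W) F

end ExactStructure

/-!
Two facts connect morphisms with objects. First, an inflation `i` with cokernel `C` lifts against a
deflation with kernel `K` as soon as `Ext¹(C, K) = 0`; together with the retract argument this
matches exact weak factorization systems with complete cotorsion pairs. Weak idempotent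
completeness enters only in the retract argument, where it ensures that a morphism is an inflation
if some `f ≫ g` starting with it is one.

Second, a class `W` of trivial objects determines a class of weak equivalences. The paper's
description, inflations with cokernel in `W` followed by deflations with kernel in `W`, does not
show the 2-out-of-3 property. Embedding the source `A` of `w : A ⟶ B` into an object `J` of `W`
makes `(w, j) : A ⟶ B ⊞ J` an inflation, whose cokernel is a mapping cone of `w`. Membership of
this cone in `W` does not depend on `j`, the cones of `f`, `f ≫ g` and `g` form a conflation, and
retracts of morphisms induce retracts of cones, so that the closure properties of `W` pass to the
morphisms with cone in `W`.
-/

namespace ExactStructure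

section Opposites

variable {E : Type u} [Category.{v} E] [Preadditive E]

/-- The opposites of the short sequences in a class. It makes results on inflations available for
deflations. -/
def opConflation (conf : ObjectProperty (ShortComplex E)) : ObjectProperty (ShortComplex Eᵒᵖ) :=
  fun S => conf S.unop

lemma firstMaps_opConflation_top_iff {conf : ObjectProperty (ShortComplex E)} {A B : Eᵒᵖ}
    {f : A ⟶ B} : firstMaps (opConflation conf) ⊤ f ↔ secondMaps conf ⊤ f.unop :=
  ⟨fun ⟨C, p, w, h, _⟩ => ⟨C.unop, p.unop, by rw [← unop_comp, w, unop_zero], h, trivial⟩,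
    fun ⟨C, p, w, h, _⟩ => ⟨.op C, p.op, by rw [← f.op_unop, ← op_comp, w, op_zero], h, trivial⟩⟩

lemma secondMaps_opConflation_top_iff {conf : ObjectProperty (ShortComplex E)} {A B : Eᵒᵖ}
    {f : A ⟶ B} : secondMaps (opConflation conf) ⊤ f ↔ firstMaps conf ⊤ f.unop :=
  ⟨fun ⟨C, p, w, h, _⟩ => ⟨C.unop, p.unop, by rw [← unop_comp, w, unop_zero], h, trivial⟩,
    fun ⟨C, p, w, h, _⟩ => ⟨.op C, p.op, by rw [← f.op_unop, ← op_comp, w, op_zero], h, trivial⟩⟩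

variable [HasZeroObject E] [HasBinaryBiproducts E]

/-- The opposite exact structure, in which inflations and deflations are exchanged. -/
def op (X : ExactStructure E) : ExactStructure Eᵒᵖ where
  conflation := opConflation X.conflation
  isClosedUnderIsomorphisms := by
    have := X.isClosedUnderIsomorphisms
    refine ⟨fun {S T} e h => X.conflation.prop_of_iso (?_ : S.unop ≅ T.unop) h⟩
    exact ⟨ShortComplex.unopMap e.inv, ShortComplex.unopMap e.hom,
      congrArg ShortComplex.unopMap e.hom_inv_id, congrArg ShortComplex.unopMap e.inv_hom_id⟩
  isKernel S h := (X.isCokernel _ h).map fun l => CokernelCofork.IsColimit.ofπOp _ S.unop.zero l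
  isCokernel S h := (X.isKernel _ h).map fun l => KernelFork.IsLimit.ofιOp _ S.unop.zero l
  inflation_id A := firstMaps_opConflation_top_iff.2 (X.deflation_id A.unop)
  deflation_id A := secondMaps_opConflation_top_iff.2 (X.inflation_id A.unop)
  inflation_comp f g hf hg := firstMaps_opConflation_top_iff.2
    (X.deflation_comp g.unop f.unop (firstMaps_opConflation_top_iff.1 hg)
      (firstMaps_opConflation_top_iff.1 hf))
  deflation_comp f g hf hg := secondMaps_opConflation_top_iff.2
    (X.inflation_comp g.unop f.unop (secondMaps_opConflation_top_iff.1 hg)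
      (secondMaps_opConflation_top_iff.1 hf))
  inflation_pushout i f hi := by
    obtain ⟨Y, g, p, sq, hp⟩ :=
      X.deflation_pullback i.unop f.unop (firstMaps_opConflation_top_iff.1 hi)
    exact ⟨.op Y, g.op, p.op, sq.op.flip, firstMaps_opConflation_top_iff.2 hp⟩
  deflation_pullback p g hp := by
    obtain ⟨Y, f, i, sq, hi⟩ :=
      X.inflation_pushout p.unop g.unop (secondMaps_opConflation_top_iff.1 hp)
    exact ⟨.op Y, f.op, i.op, sq.op.flip, secondMaps_opConflation_top_iff.2 hi⟩

end Opposites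

variable {E : Type u} [Category.{v} E] [Preadditive E] [HasZeroObject E] [HasBinaryBiproducts E]
  {X : ExactStructure E}

section Conflations

/-- The composable morphisms `i` and `p` form a conflation `0 ⟶ A ⟶ B ⟶ C ⟶ 0`. The vanishing of
`i ≫ p` is part of the predicate, so that it can be used without bundling a `ShortComplex`. -/
def IsConflation (X : ExactStructure E) {A B C : E} (i : A ⟶ B) (p : B ⟶ C) : Prop :=
  ∃ w : i ≫ p = 0, X.conflation (ShortComplex.mk i p w)

variable {A B C : E} {i : A ⟶ B} {p : B ⟶ C}

lemma infl_iff {S : ObjectProperty E} :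
    X.Infl S i ↔ ∃ (C : E) (p : B ⟶ C), X.IsConflation i p ∧ S C :=
  ⟨fun ⟨C, p, w, h, hC⟩ => ⟨C, p, ⟨w, h⟩, hC⟩, fun ⟨C, p, ⟨w, h⟩, hC⟩ => ⟨C, p, w, h, hC⟩⟩

lemma defl_iff {S : ObjectProperty E} :
    X.Defl S p ↔ ∃ (A : E) (i : A ⟶ B), X.IsConflation i p ∧ S A :=
  ⟨fun ⟨A, i, w, h, hA⟩ => ⟨A, i, ⟨w, h⟩, hA⟩, fun ⟨A, i, ⟨w, h⟩, hA⟩ => ⟨A, i, w, h, hA⟩⟩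

namespace IsConflation

lemma infl (h : X.IsConflation i p) {S : ObjectProperty E} (hC : S C) : X.Infl S i :=
  infl_iff.2 ⟨C, p, h, hC⟩

lemma defl (h : X.IsConflation i p) {S : ObjectProperty E} (hA : S A) : X.Defl S p :=
  defl_iff.2 ⟨A, i, h, hA⟩

lemma op (h : X.IsConflation i p) : X.op.IsConflation p.op i.op :=
  ⟨by rw [← op_comp, h.1, op_zero], h.2⟩

lemma unop {A B C : Eᵒᵖ} {i : A ⟶ B} {p : B ⟶ C} (h : X.op.IsConflation i p) :
    X.IsConflation p.unop i.unop :=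
  ⟨by rw [← unop_comp, h.1, unop_zero], h.2⟩

lemma zero (h : X.IsConflation i p) : i ≫ p = 0 := h.1

lemma of_iso (h : X.IsConflation i p) {A' B' C' : E} {i' : A' ⟶ B'} {p' : B' ⟶ C'}
    (a : A ≅ A') (b : B ≅ B') (c : C ≅ C') (hi : i ≫ b.hom = a.hom ≫ i')
    (hp : p ≫ c.hom = b.hom ≫ p') : X.IsConflation i' p' := by
  have w : i' ≫ p' = 0 := by
    rw [← cancel_epi a.hom, ← reassoc_of% hi, ← hp, reassoc_of% h.zero, zero_comp, comp_zero]
  have := X.isClosedUnderIsomorphisms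
  exact ⟨w, X.conflation.prop_of_iso (ShortComplex.isoMk a b c hi.symm hp.symm) h.2⟩

lemma neg (h : X.IsConflation i p) : X.IsConflation (-i) p :=
  h.of_iso (-Iso.refl A) (Iso.refl B) (Iso.refl C) (by simp) (by simp)

lemma comp_iso (h : X.IsConflation i p) {B' : E} (e : B ≅ B') :
    X.IsConflation (i ≫ e.hom) (e.inv ≫ p) :=
  h.of_iso (Iso.refl A) e (Iso.refl C) (by simp) (by simp)

lemma exists_lift (h : X.IsConflation i p) {T : E} (f : T ⟶ B) (hf : f ≫ p = 0) :
    ∃ g : T ⟶ A, g ≫ i = f := by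
  obtain ⟨l⟩ := X.isKernel _ h.2
  exact ⟨_, (KernelFork.IsLimit.lift' l f hf).2⟩

lemma exists_desc (h : X.IsConflation i p) {T : E} (f : B ⟶ T) (hf : i ≫ f = 0) :
    ∃ g : C ⟶ T, p ≫ g = f := by
  obtain ⟨l⟩ := X.isCokernel _ h.2
  exact ⟨_, (CokernelCofork.IsColimit.desc' l f hf).2⟩

lemma mono (h : X.IsConflation i p) : Mono i := by
  obtain ⟨l⟩ := X.isKernel _ h.2
  exact mono_of_isLimit_fork l

lemma epi (h : X.IsConflation i p) : Epi p := by
  obtain ⟨l⟩ := X.isCokernel _ h.2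
  exact epi_of_isColimit_cofork l

lemma of_isColimit (h : X.IsConflation i p) {C' : E} {p' : B ⟶ C'} {w : i ≫ p' = 0}
    (l : IsColimit (CokernelCofork.ofπ p' w)) : X.IsConflation i p' := by
  obtain ⟨l₀⟩ := X.isCokernel _ h.2
  exact h.of_iso (Iso.refl A) (Iso.refl B) (l₀.coconePointUniqueUpToIso l) (by simp)
    ((l₀.comp_coconePointUniqueUpToIso_hom l WalkingParallelPair.one).trans
      (Category.id_comp p').symm)

lemma exists_iso_cokernel (h : X.IsConflation i p) {C' : E} {p' : B ⟶ C'}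
    (h' : X.IsConflation i p') : ∃ e : C ≅ C', p ≫ e.hom = p' := by
  obtain ⟨l⟩ := X.isCokernel _ h.2
  obtain ⟨l'⟩ := X.isCokernel _ h'.2
  exact ⟨l.coconePointUniqueUpToIso l',
    l.comp_coconePointUniqueUpToIso_hom l' WalkingParallelPair.one⟩

lemma exists_iso_kernel (h : X.IsConflation i p) {A' : E} {i' : A' ⟶ B}
    (h' : X.IsConflation i' p) : ∃ e : A ≅ A', e.hom ≫ i' = i := by
  obtain ⟨e, he⟩ := h'.op.exists_iso_cokernel h.op
  exact ⟨e.unop, congrArg Quiver.Hom.unop he⟩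

lemma isPushout_zero (h : X.IsConflation i p) : IsPushout i (0 : A ⟶ (0 : E)) p 0 := by
  obtain ⟨l⟩ := X.isCokernel _ h.2
  refine ⟨⟨by rw [h.zero, zero_comp]⟩, ⟨PushoutCocone.IsColimit.mk _
    (fun c => l.desc (CokernelCofork.ofπ c.inl (by rw [c.condition, zero_comp])))
    (fun c => l.fac (CokernelCofork.ofπ c.inl (by rw [c.condition, zero_comp])) .one)
    (fun c => (isZero_zero E).eq_of_src _ _) fun c m hm _ => ?_⟩⟩
  exact Cofork.IsColimit.hom_ext l (hm.trans (l.fac (CokernelCofork.ofπ c.inl _) .one).symm)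

lemma of_isPushout_zero (h : X.IsConflation i p) {C' : E} {p' : B ⟶ C'}
    (sq : IsPushout i (0 : A ⟶ (0 : E)) p' 0) : X.IsConflation i p' :=
  h.of_iso (Iso.refl A) (Iso.refl B) (h.isPushout_zero.isoIsPushout _ _ sq) (by simp) (by simp)

lemma exists_pushout (h : X.IsConflation i p) {A' : E} (f : A ⟶ A') :
    ∃ (B' : E) (f' : B ⟶ B') (i' : A' ⟶ B') (p' : B' ⟶ C),
      IsPushout i f f' i' ∧ X.IsConflation i' p' ∧ f' ≫ p' = p := by
  obtain ⟨B', f', i', sq, hi'⟩ := X.inflation_pushout i f (h.infl trivial)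
  obtain ⟨_, _, h', -⟩ := infl_iff.1 hi'
  have outer : IsPushout i (f ≫ (0 : A' ⟶ (0 : E))) (f' ≫ sq.desc p 0 (by simp [h.zero])) 0 := by
    simpa using h.isPushout_zero
  exact ⟨B', f', i', sq.desc p 0 (by simp [h.zero]), sq,
    h'.of_isPushout_zero (.of_top outer (by simp) sq), sq.inl_desc _ _ _⟩

lemma exists_pullback (h : X.IsConflation i p) {C' : E} (g : C' ⟶ C) :
    ∃ (B' : E) (g' : B' ⟶ B) (p' : B' ⟶ C') (i' : A ⟶ B'),
      IsPullback g' p' p g ∧ X.IsConflation i' p' ∧ i' ≫ g' = i := by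
  obtain ⟨B', g', p', i', sq, h', w⟩ := h.op.exists_pushout g.op
  exact ⟨B'.unop, g'.unop, p'.unop, i'.unop, sq.unop.flip, h'.unop, congrArg Quiver.Hom.unop w⟩

lemma of_isPushout (h : X.IsConflation i p) {A' B' : E} {f : A ⟶ A'} {f' : B ⟶ B'}
    {i' : A' ⟶ B'} (sq : IsPushout i f f' i') {p' : B' ⟶ C} (hp' : f' ≫ p' = p)
    (w : i' ≫ p' = 0) : X.IsConflation i' p' := by
  obtain ⟨B'', f'', i'', p'', sq', h', hp''⟩ := h.exists_pushout f
  refine h'.of_iso (Iso.refl A') (sq'.isoIsPushout _ _ sq) (Iso.refl C) (by simp)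
    (sq'.hom_ext ?_ ?_)
  · simp [hp', hp'']
  · simp [w, h'.zero]

end IsConflation

end Conflations

section Biproducts

variable {A B C : E} {i : A ⟶ B} {p : B ⟶ C}

lemma isConflation_zero_id (X : ExactStructure E) (A : E) :
    X.IsConflation (0 : (0 : E) ⟶ A) (𝟙 A) := by
  obtain ⟨K, i, h, -⟩ := defl_iff.1 (X.deflation_id A)
  have hi : i = 0 := by simpa using h.zero
  have := h.mono
  exact h.of_iso ((IsZero.iff_id_eq_zero K).2 (by rw [← cancel_mono i, hi]; simp)).isoZero
    (Iso.refl A) (Iso.refl A) (by simp [hi]) rfl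

lemma isConflation_id_zero (X : ExactStructure E) (A : E) :
    X.IsConflation (𝟙 A) (0 : A ⟶ (0 : E)) :=
  (X.op.isConflation_zero_id (.op A)).unop.of_iso (Iso.refl A) (Iso.refl A)
    (isZero_zero Eᵒᵖ).unop.isoZero rfl ((isZero_zero E).eq_of_tgt _ _)

lemma isConflation_inl_snd (X : ExactStructure E) (A B : E) :
    X.IsConflation (biprod.inl : A ⟶ A ⊞ B) biprod.snd :=
  (X.isConflation_zero_id B).of_isPushout (IsPushout.of_has_biproduct A B).flip (by simp)
    (by simp)

lemma isConflation_inr_fst (X : ExactStructure E) (A B : E) :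
    X.IsConflation (biprod.inr : B ⟶ A ⊞ B) biprod.fst :=
  (X.isConflation_zero_id A).of_isPushout (IsPushout.of_has_biproduct A B) (by simp)
    (by simp)

lemma isConflation_of_splitting (X : ExactStructure E) {S : ShortComplex E} (σ : S.Splitting) :
    X.IsConflation S.f S.g :=
  (X.isConflation_inl_snd S.X₁ S.X₃).of_iso (Iso.refl _) σ.isoBinaryBiproduct.symm (Iso.refl _)
    (by simp) (by ext <;> simp)

namespace IsConflation

lemma map_id (h : X.IsConflation i p) (D : E) :
    X.IsConflation (biprod.map i (𝟙 D)) (biprod.fst ≫ p) := by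
  have sq : IsPushout i biprod.inl biprod.inl (biprod.map i (𝟙 D)) := by
    refine (IsPushout.of_top ?_ (by simp) (IsPushout.of_has_biproduct A D).flip).flip
    simpa using (IsPushout.of_has_biproduct B D).flip
  exact h.of_isPushout sq (by simp) (by simp [h.zero])

lemma exists_cokernel_comp (h : X.IsConflation i p) {D B' : E} {j : B ⟶ B'} {q : B' ⟶ D}
    (h' : X.IsConflation j q) :
    ∃ (M : E) (π : B' ⟶ M) (a : C ⟶ M) (b : M ⟶ D), X.IsConflation (i ≫ j) π ∧
      X.IsConflation a b ∧ IsPushout j p π a ∧ π ≫ b = q := by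
  obtain ⟨M, π, a, b, sq, hab, w⟩ := h'.exists_pushout p
  obtain ⟨_, _, hij, -⟩ := infl_iff.1 (X.inflation_comp i j (h.infl trivial) (h'.infl trivial))
  exact ⟨M, π, a, b, hij.of_isPushout_zero (by simpa using h.isPushout_zero.paste_horiz sq), hab,
    sq, w⟩

lemma exists_kernel_comp (h : X.IsConflation i p) {K D : E} {k : K ⟶ C} {q : C ⟶ D}
    (h' : X.IsConflation k q) :
    ∃ (M : E) (m : M ⟶ B) (a : A ⟶ M) (b : M ⟶ K), X.IsConflation m (p ≫ q) ∧
      X.IsConflation a b ∧ a ≫ m = i ∧ m ≫ p = b ≫ k := by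
  obtain ⟨M, m, b, a, hm, hab, sq, w⟩ := h'.op.exists_cokernel_comp h.op
  exact ⟨M.unop, m.unop, a.unop, b.unop, hm.unop, hab.unop, congrArg Quiver.Hom.unop w,
    congrArg Quiver.Hom.unop sq.w⟩

lemma exists_retraction (h : X.IsConflation i p) {s : C ⟶ B} (hs : s ≫ p = 𝟙 C) :
    ∃ r : B ⟶ A, X.IsConflation s r ∧ i ≫ r = 𝟙 A := by
  obtain ⟨r, hr⟩ := h.exists_lift (𝟙 B - p ≫ s) (by simp [hs])
  have := h.mono
  have hir : i ≫ r = 𝟙 A := by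
    rw [← cancel_mono i, Category.assoc, hr]
    simp [reassoc_of% h.zero]
  have hsr : s ≫ r = 0 := by
    rw [← cancel_mono i, Category.assoc, hr]
    simp [reassoc_of% hs]
  exact ⟨r, X.isConflation_of_splitting (S := .mk s r hsr)
    { r := p, s := i, f_r := hs, s_g := hir, id := by simp [hr] }, hir⟩

lemma exists_section (h : X.IsConflation i p) {r : B ⟶ A} (hr : i ≫ r = 𝟙 A) :
    ∃ s : C ⟶ B, s ≫ p = 𝟙 C ∧ p ≫ s = 𝟙 B - r ≫ i := by
  obtain ⟨s, hs⟩ := h.exists_desc (𝟙 B - r ≫ i) (by simp [reassoc_of% hr])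
  have := h.epi
  refine ⟨s, ?_, hs⟩
  rw [← cancel_epi p, reassoc_of% hs]
  simp [h.zero]

lemma exists_cokernel_of_comp_deflation (h : X.IsConflation i p) {K D : E} {f : K ⟶ B} {q : C ⟶ D}
    (hfp : X.IsConflation (f ≫ p) q) :
    ∃ (M : E) (c : B ⟶ M) (b : M ⟶ D),
      X.IsConflation f c ∧ X.IsConflation (i ≫ c) b ∧ c ≫ b = p ≫ q := by
  obtain ⟨N, m, a, b, hm, hab, ham, hmp⟩ := h.exists_kernel_comp hfp
  obtain ⟨s, rfl⟩ := hm.exists_lift f (by simpa using hfp.zero)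
  have := hfp.mono
  have hsb : s ≫ b = 𝟙 K := by
    rw [← cancel_mono ((s ≫ m) ≫ p), Category.assoc, ← hmp]
    simp
  obtain ⟨r, hr, har⟩ := hab.exists_retraction hsb
  obtain ⟨M, c, a', b', hc, hab', sq, w⟩ := hr.exists_cokernel_comp hm
  have hic : i ≫ c = a' := by rw [← ham, Category.assoc, sq.w, reassoc_of% har]
  exact ⟨M, c, b', hc, hic ▸ hab', w⟩

lemma exists_kernel_of_inflation_comp (h : X.IsConflation i p) {K D : E} {f : B ⟶ D} {k : K ⟶ A}
    (hif : X.IsConflation k (i ≫ f)) :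
    ∃ (M : E) (c : M ⟶ B) (b : K ⟶ M),
      X.IsConflation c f ∧ X.IsConflation b (c ≫ p) ∧ b ≫ c = k ≫ i := by
  obtain ⟨M, c, b, hc, hb, w⟩ := h.op.exists_cokernel_of_comp_deflation (f := f.op) hif.op
  exact ⟨M.unop, c.unop, b.unop, hc.unop, hb.unop, congrArg Quiver.Hom.unop w⟩

lemma exists_isConflation_lift (h : X.IsConflation i p) {D : E} (f : A ⟶ D) :
    ∃ (M : E) (q : D ⊞ B ⟶ M) (b : M ⟶ C),
      X.IsConflation (biprod.lift f i) q ∧ X.IsConflation (biprod.inl ≫ q) b := by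
  obtain ⟨M, q, b, hq, hb, -⟩ := (X.isConflation_inl_snd D B).exists_cokernel_of_comp_deflation
    (f := biprod.lift f i) (by simpa using h)
  exact ⟨M, q, b, hq, hb⟩

lemma exists_isConflation_desc (h : X.IsConflation i p) {D : E} (f : D ⟶ C) :
    ∃ (M : E) (k : M ⟶ D ⊞ B), X.IsConflation k (biprod.desc f p) := by
  obtain ⟨M, k, -, hk, -⟩ := (X.isConflation_inr_fst D B).exists_kernel_of_inflation_comp
    (f := biprod.desc f p) (by simpa using h)
  exact ⟨M, k, hk⟩

lemma lift_of_isPushout (h : X.IsConflation i p) {D P : E} {f : A ⟶ D} {f' : B ⟶ P} {i' : D ⟶ P}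
    (sq : IsPushout i f f' i') : X.IsConflation (biprod.lift f (-i)) (biprod.desc i' f') := by
  obtain ⟨_, _, _, h', -⟩ := h.neg.exists_isConflation_lift f
  exact h'.of_isColimit sq.flip.isColimitCokernelCofork

end IsConflation

end Biproducts

section WeaklyIdempotentComplete

lemma _root_.WeaklyIdempotentComplete.exists_splitting {E : Type u} [Category.{v} E]
    [Preadditive E] (hE : WeaklyIdempotentComplete E) {B C : E} {s : C ⟶ B} {r : B ⟶ C}
    (hr : s ≫ r = 𝟙 C) :
    ∃ (K : E) (k : K ⟶ B) (w : k ≫ r = 0), Nonempty (ShortComplex.mk k r w).Splitting := by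
  have := hE s ⟨⟨⟨r, hr⟩⟩⟩
  let k : cokernel s ⟶ B := cokernel.desc s (𝟙 B - r ≫ s) (by simp [reassoc_of% hr])
  have hk : cokernel.π s ≫ k = 𝟙 B - r ≫ s := cokernel.π_desc _ _ _
  have w : k ≫ r = 0 := by
    rw [← cancel_epi (cokernel.π s), reassoc_of% hk]
    simp [hr]
  have hkπ : k ≫ cokernel.π s = 𝟙 _ := by
    rw [← cancel_epi (cokernel.π s), reassoc_of% hk]
    simp
  exact ⟨_, k, w, ⟨{ r := cokernel.π s, s := s, f_r := hkπ, s_g := hr, id := by simp [hk] }⟩⟩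

lemma _root_.WeaklyIdempotentComplete.op {E : Type u} [Category.{v} E] [Preadditive E]
    [HasZeroObject E] (hE : WeaklyIdempotentComplete E) : WeaklyIdempotentComplete Eᵒᵖ := by
  rintro A B s ⟨⟨⟨r, hr⟩⟩⟩
  obtain ⟨K, k, w, ⟨σ⟩⟩ := hE.exists_splitting (congrArg Quiver.Hom.unop hr)
  exact ⟨⟨⟨_, σ.op.gIsCokernel⟩⟩⟩

namespace IsConflation

variable {A B C D : E} {f : A ⟶ B} {g : B ⟶ C}

lemma exists_cokernel_of_lift_zero (hE : WeaklyIdempotentComplete E) {q : B ⊞ C ⟶ D}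
    (h : X.IsConflation (biprod.lift f (0 : A ⟶ C)) q) :
    ∃ (K : E) (p : B ⟶ K), X.IsConflation f p := by
  -- The second projection of `B ⊞ C` factors through `q` as a retraction, hence as a deflation. So
  -- `f` is the inclusion of the kernel of `q` into the kernel of a deflation with the same source.
  obtain ⟨t, ht⟩ := h.exists_desc biprod.snd (by simp)
  obtain ⟨K, k, w, ⟨σ⟩⟩ := hE.exists_splitting (s := biprod.inr ≫ q) (r := t) (by simp [ht])
  obtain ⟨M, m, a, b, hm, hab, ham, -⟩ := h.exists_kernel_comp (X.isConflation_of_splitting σ)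
  obtain ⟨e, he⟩ := (ht ▸ hm).exists_iso_kernel (X.isConflation_inl_snd B C)
  refine ⟨K, e.inv ≫ b, hab.of_iso (Iso.refl A) e (Iso.refl K) ?_ (by simp)⟩
  simpa [← he] using (ham =≫ biprod.fst)

lemma exists_cokernel_of_comp (hE : WeaklyIdempotentComplete E) {q : C ⟶ D}
    (h : X.IsConflation (f ≫ g) q) :
    ∃ (K : E) (p : B ⟶ K), X.IsConflation f p := by
  obtain ⟨_, _, _, h', -⟩ := h.exists_isConflation_lift f
  have shear : biprod.lift f (f ≫ g) ≫ (Biprod.unipotentUpper (-g)).hom = biprod.lift f 0 := by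
    ext <;> simp
  exact exists_cokernel_of_lift_zero hE (shear ▸ h'.comp_iso (Biprod.unipotentUpper (-g)))

lemma exists_kernel_of_comp (hE : WeaklyIdempotentComplete E) {k : D ⟶ A}
    (h : X.IsConflation k (f ≫ g)) :
    ∃ (L : E) (l : L ⟶ B), X.IsConflation l g := by
  obtain ⟨L, l, h'⟩ := exists_cokernel_of_comp hE.op (f := g.op) h.op
  exact ⟨_, _, h'.unop⟩

end IsConflation

end WeaklyIdempotentComplete

section ExtOrthogonal

/-- The vanishing of `Ext¹(A, B)`, expressed through conflations: each of the form
`0 ⟶ B ⟶ M ⟶ A ⟶ 0` splits. -/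
def ExtOrthogonal (X : ExactStructure E) (A B : E) : Prop :=
  ∀ ⦃M : E⦄ (i : B ⟶ M) (p : M ⟶ A), X.IsConflation i p → ∃ s : A ⟶ M, s ≫ p = 𝟙 A

variable {A B : E}

namespace Extension

lemma isConflation (ε : X.Extension A B) : X.IsConflation ε.i ε.p := ⟨ε.zero, ε.conflation⟩

/-- The split extension `B ⊞ A`. -/
noncomputable def split (X : ExactStructure E) (A B : E) : X.Extension A B where
  M := B ⊞ A
  i := biprod.inl
  p := biprod.snd
  zero := (X.isConflation_inl_snd B A).zero
  conflation := (X.isConflation_inl_snd B A).2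

lemma exists_section_iff_of_hom {ε₁ ε₂ : X.Extension A B} (f : ε₁.M ⟶ ε₂.M)
    (hi : ε₁.i ≫ f = ε₂.i) (hp : f ≫ ε₂.p = ε₁.p) :
    (∃ s, s ≫ ε₁.p = 𝟙 A) ↔ ∃ s, s ≫ ε₂.p = 𝟙 A := by
  refine ⟨fun ⟨s, hs⟩ => ⟨s ≫ f, by rw [Category.assoc, hp, hs]⟩, fun ⟨s, hs⟩ => ?_⟩
  obtain ⟨r, -, hr⟩ := ε₂.isConflation.exists_retraction hs
  obtain ⟨s', hs', -⟩ := ε₁.isConflation.exists_section (r := f ≫ r) (by rw [reassoc_of% hi, hr])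
  exact ⟨s', hs'⟩

end Extension

/-- The extensions representing the class are split. -/
def YonedaExt.IsSplit : X.YonedaExt A B → Prop :=
  Quot.lift (fun ε => ∃ s, s ≫ ε.p = 𝟙 A) fun _ _ ⟨f, hi, hp⟩ =>
    propext (Extension.exists_section_iff_of_hom f hi hp)

lemma YonedaExt.isSplit_iff_eq_mk_split {x : X.YonedaExt A B} :
    x.IsSplit ↔ x = Quot.mk _ (Extension.split X A B) := by
  induction x using Quot.ind with | mk ε =>
  refine ⟨fun ⟨s, hs⟩ => ?_, fun h => h ▸ ⟨biprod.inr, biprod.inr_snd⟩⟩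
  obtain ⟨r, -, hr⟩ := ε.isConflation.exists_retraction hs
  refine Quot.sound ⟨biprod.lift r ε.p, ?_, biprod.lift_snd _ _⟩
  change ε.i ≫ biprod.lift r ε.p = biprod.inl
  ext <;> simp [hr, ε.zero]

lemma subsingleton_yonedaExt_iff : Subsingleton (X.YonedaExt A B) ↔ X.ExtOrthogonal A B := by
  refine ⟨fun hs M i p h => ?_, fun h => ⟨fun x y => ?_⟩⟩
  · let ε : X.Extension A B := ⟨M, i, p, h.1, h.2⟩
    exact YonedaExt.isSplit_iff_eq_mk_split.2 (hs.elim (Quot.mk _ ε) _)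
  · have isSplit (x : X.YonedaExt A B) : x.IsSplit :=
      Quot.ind (fun ε => h ε.i ε.p ε.isConflation) x
    rw [YonedaExt.isSplit_iff_eq_mk_split.1 (isSplit x),
      YonedaExt.isSplit_iff_eq_mk_split.1 (isSplit y)]

lemma leftPerp_iff {S : ObjectProperty E} : X.leftPerp S A ↔ ∀ B, S B → X.ExtOrthogonal A B :=
  forall₂_congr fun _ _ => subsingleton_yonedaExt_iff

lemma rightPerp_iff {S : ObjectProperty E} : X.rightPerp S B ↔ ∀ A, S A → X.ExtOrthogonal A B :=
  forall₂_congr fun _ _ => subsingleton_yonedaExt_iff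

namespace ExtOrthogonal

lemma hasLiftingProperty (h : X.ExtOrthogonal A B) {Y Y' Z Z' : E} {i : Y ⟶ Y'} {c : Y' ⟶ A}
    (hi : X.IsConflation i c) {k : B ⟶ Z} {p : Z ⟶ Z'} (hp : X.IsConflation k p) :
    HasLiftingProperty i p := by
  refine ⟨fun {u v} sq => ?_⟩
  obtain ⟨P, g, p', k', pb, hp', -⟩ := hp.exists_pullback v
  obtain ⟨s, hsg, hsp⟩ : ∃ s, s ≫ g = u ∧ s ≫ p' = i := pb.exists_lift u i sq.w
  obtain ⟨M, m, b, hs, hb, -⟩ := hp'.exists_cokernel_of_comp_deflation (hsp ▸ hi)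
  obtain ⟨σ, hσ⟩ := h _ _ hb
  obtain ⟨r, -, hr⟩ := hb.exists_retraction hσ
  obtain ⟨τ, hτ, hpτ⟩ := hp'.exists_section (r := m ≫ r) (by rwa [← Category.assoc])
  have hiτ : i ≫ τ = s := by
    rw [← hsp, Category.assoc, hpτ]
    simp [reassoc_of% hs.zero]
  exact ⟨⟨⟨τ ≫ g, by rw [reassoc_of% hiτ, hsg], by rw [Category.assoc, pb.w, reassoc_of% hτ]⟩⟩⟩

lemma exists_lift (h : X.ExtOrthogonal A B) {Y Z : E} {k : B ⟶ Y} {q : Y ⟶ Z}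
    (hq : X.IsConflation k q) (v : A ⟶ Z) : ∃ t : A ⟶ Y, t ≫ q = v := by
  have := h.hasLiftingProperty (X.isConflation_zero_id A) hq
  have sq : CommSq (0 : (0 : E) ⟶ Y) (0 : (0 : E) ⟶ A) q v := ⟨by simp⟩
  exact ⟨sq.lift, sq.fac_right⟩

lemma of_isConflation {A₁ A₂ : E} {i : A₁ ⟶ A} {p : A ⟶ A₂} (h : X.IsConflation i p)
    (h₁ : X.ExtOrthogonal A₁ B) (h₂ : X.ExtOrthogonal A₂ B) : X.ExtOrthogonal A B := by
  intro M k q hq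
  obtain ⟨t, ht⟩ := h₁.exists_lift hq i
  have := h₂.hasLiftingProperty h hq
  have sq : CommSq t i q (𝟙 A) := ⟨by simpa using ht⟩
  exact ⟨sq.lift, sq.fac_right⟩

lemma of_iso_left (h : X.ExtOrthogonal A B) {A' : E} (e : A ≅ A') : X.ExtOrthogonal A' B := by
  intro M k q hq
  obtain ⟨t, ht⟩ := h.exists_lift hq e.hom
  exact ⟨e.inv ≫ t, by simp [ht]⟩

lemma of_iso_right (h : X.ExtOrthogonal A B) {B' : E} (e : B ≅ B') : X.ExtOrthogonal A B' :=
  fun _ k q hq =>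
    h (e.hom ≫ k) q (hq.of_iso e.symm (Iso.refl _) (Iso.refl _) (by simp) (by simp))

end ExtOrthogonal

namespace IsConflation

variable {C : E} {i : A ⟶ B} {p : B ⟶ C} {S : ObjectProperty E}

lemma extOrthogonal_of_rlp (h : X.IsConflation i p) (hp : (X.Infl S).rlp p) {D : E} (hD : S D) :
    X.ExtOrthogonal D A := by
  intro M j c hc
  have := hp j (hc.infl hD)
  have sq : CommSq i j p 0 := ⟨by simp [h.zero]⟩
  obtain ⟨t, ht⟩ := h.exists_lift sq.lift sq.fac_right
  have := h.mono
  obtain ⟨s, hs, -⟩ :=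
    hc.exists_section (r := t) (by rw [← cancel_mono i, Category.assoc, ht]; simp)
  exact ⟨s, hs⟩

lemma extOrthogonal_of_llp (h : X.IsConflation i p) (hi : (X.Defl S).llp i) {D : E} (hD : S D) :
    X.ExtOrthogonal C D := by
  intro M k q hq
  have := hi q (hq.defl hD)
  have sq : CommSq 0 i q p := ⟨by simp [h.zero]⟩
  obtain ⟨t, ht⟩ := h.exists_desc sq.lift sq.fac_left
  have := h.epi
  exact ⟨t, by rw [← cancel_epi p, reassoc_of% ht]; simp⟩

end IsConflation

end ExtOrthogonal

section ClosedUnderIsomorphisms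

variable {A B C : E} {S T : ObjectProperty E} [S.IsClosedUnderIsomorphisms]

lemma IsConflation.infl_iff_cokernel {i : A ⟶ B} {p : B ⟶ C} (h : X.IsConflation i p) :
    X.Infl S i ↔ S C := by
  refine ⟨fun h' => ?_, h.infl⟩
  obtain ⟨C', p', hp', hC'⟩ := infl_iff.1 h'
  obtain ⟨e, -⟩ := hp'.exists_iso_cokernel h
  exact S.prop_of_iso e hC'

lemma IsConflation.defl_iff_kernel {i : A ⟶ B} {p : B ⟶ C} (h : X.IsConflation i p) :
    X.Defl S p ↔ S A := by
  refine ⟨fun h' => ?_, h.defl⟩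
  obtain ⟨A', i', hi', hA'⟩ := defl_iff.1 h'
  obtain ⟨e, -⟩ := hi'.exists_iso_kernel h
  exact S.prop_of_iso e hA'

lemma fromZero_infl : fromZero (X.Infl S) = S := by
  ext A
  exact (X.isConflation_zero_id A).infl_iff_cokernel

lemma toZero_defl : toZero (X.Defl S) = S := by
  ext A
  exact (X.isConflation_id_zero A).defl_iff_kernel

lemma infl_inf : X.Infl (S ⊓ T) = X.Infl S ⊓ X.Infl T := by
  ext A B f
  refine ⟨fun h => ?_, fun ⟨hS, hT⟩ => ?_⟩
  · obtain ⟨C, p, hp, hC⟩ := infl_iff.1 h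
    exact ⟨hp.infl hC.1, hp.infl hC.2⟩
  · obtain ⟨C, p, hp, hC⟩ := infl_iff.1 hT
    exact hp.infl ⟨hp.infl_iff_cokernel.1 hS, hC⟩

lemma defl_inf : X.Defl (S ⊓ T) = X.Defl S ⊓ X.Defl T := by
  ext A B f
  refine ⟨fun h => ?_, fun ⟨hS, hT⟩ => ?_⟩
  · obtain ⟨K, k, hk, hK⟩ := defl_iff.1 h
    exact ⟨hk.defl hK.1, hk.defl hK.2⟩
  · obtain ⟨K, k, hk, hK⟩ := defl_iff.1 hT
    exact hk.defl ⟨hk.defl_iff_kernel.1 hS, hK⟩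

end ClosedUnderIsomorphisms

section CotorsionPairs

namespace IsCompleteCotorsionPair

variable {A B : ObjectProperty E}

lemma left_iff (h : X.IsCompleteCotorsionPair A B) {Y : E} :
    A Y ↔ ∀ Z, B Z → X.ExtOrthogonal Y Z := by
  rw [← leftPerp_iff, ← h.left_eq]

lemma right_iff (h : X.IsCompleteCotorsionPair A B) {Z : E} :
    B Z ↔ ∀ Y, A Y → X.ExtOrthogonal Y Z := by
  rw [← rightPerp_iff, h.right_eq]

lemma isClosedUnderIsomorphisms_left (h : X.IsCompleteCotorsionPair A B) :
    A.IsClosedUnderIsomorphisms :=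
  ⟨fun e hY => h.left_iff.2 fun Z hZ => (h.left_iff.1 hY Z hZ).of_iso_left e⟩

lemma isClosedUnderIsomorphisms_right (h : X.IsCompleteCotorsionPair A B) :
    B.IsClosedUnderIsomorphisms :=
  ⟨fun e hZ => h.right_iff.2 fun Y hY => (h.right_iff.1 hZ Y hY).of_iso_right e⟩

lemma left_of_isConflation (h : X.IsCompleteCotorsionPair A B) {A₁ A₂ A₃ : E} {i : A₁ ⟶ A₂}
    {p : A₂ ⟶ A₃} (hip : X.IsConflation i p) (h₁ : A A₁) (h₃ : A A₃) : A A₂ :=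
  h.left_iff.2 fun Z hZ => .of_isConflation hip (h.left_iff.1 h₁ Z hZ) (h.left_iff.1 h₃ Z hZ)

lemma exists_factorization (h : X.IsCompleteCotorsionPair A B) {Y Z : E} (f : Y ⟶ Z) :
    ∃ (V : E) (i : Y ⟶ V) (p : V ⟶ Z), X.Infl A i ∧ X.Defl B p ∧ i ≫ p = f := by
  obtain ⟨B₁, A₁, i₁, p₁, w₁, h₁, -, hA₁⟩ := h.exists_right_approx Z
  obtain ⟨K, k, hk⟩ := IsConflation.exists_isConflation_desc ⟨w₁, h₁⟩ f
  obtain ⟨B₂, A₂, i₂, p₂, w₂, h₂, hB₂, hA₂⟩ := h.exists_left_approx K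
  obtain ⟨V, g, j, q, sq, hq, hgq⟩ := hk.exists_pushout i₂
  have hg : X.IsConflation g (sq.flip.desc p₂ 0 (by simp [w₂])) :=
    .of_isPushout ⟨w₂, h₂⟩ sq.flip (sq.flip.inl_desc _ _ _) (sq.flip.inr_desc _ _ _)
  obtain ⟨M, π, a, b, hπ, hab, -⟩ := (X.isConflation_inl_snd Y A₁).exists_cokernel_comp hg
  exact ⟨V, biprod.inl ≫ g, q, hπ.infl (h.left_of_isConflation hab hA₁ hA₂), hq.defl hB₂,
    by simp [hgq]⟩

lemma hasLiftingProperty (h : X.IsCompleteCotorsionPair A B) {Y Y' Z Z' : E} {i : Y ⟶ Y'}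
    {p : Z ⟶ Z'} (hi : X.Infl A i) (hp : X.Defl B p) : HasLiftingProperty i p := by
  obtain ⟨C, c, hc, hC⟩ := infl_iff.1 hi
  obtain ⟨K, k, hk, hK⟩ := defl_iff.1 hp
  exact (h.left_iff.1 hC K hK).hasLiftingProperty hc hk

lemma rlp_infl (h : X.IsCompleteCotorsionPair A B) (hE : WeaklyIdempotentComplete E) :
    (X.Infl A).rlp = X.Defl B := by
  refine le_antisymm (fun Y Z p hp => ?_) fun Y Z p hp _ _ i hi => h.hasLiftingProperty hi hp
  -- By the retract argument a morphism with the lifting property is a factor of a deflation.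
  obtain ⟨V, i, q, hi, hq, fac⟩ := h.exists_factorization p
  have := hp i hi
  have sq : CommSq (𝟙 Y) i p q := ⟨by simp [fac]⟩
  obtain ⟨_, _, hk, -⟩ := defl_iff.1 hq
  obtain ⟨K, k, hkp⟩ := IsConflation.exists_kernel_of_comp hE (sq.fac_right ▸ hk)
  exact hkp.defl (h.right_iff.2 fun C hC => hkp.extOrthogonal_of_rlp hp hC)

lemma llp_defl (h : X.IsCompleteCotorsionPair A B) (hE : WeaklyIdempotentComplete E) :
    (X.Defl B).llp = X.Infl A := by
  refine le_antisymm (fun Y Z i hi => ?_) fun Y Z i hi _ _ p hp => h.hasLiftingProperty hi hp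
  obtain ⟨V, j, p, hj, hp, fac⟩ := h.exists_factorization i
  have := hi p hp
  have sq : CommSq j i p (𝟙 Z) := ⟨by simp [fac]⟩
  obtain ⟨_, _, hc, -⟩ := infl_iff.1 hj
  obtain ⟨C, c, hic⟩ := IsConflation.exists_cokernel_of_comp hE (sq.fac_left ▸ hc)
  exact hic.infl (h.left_iff.2 fun K hK => hic.extOrthogonal_of_llp hi hK)

lemma isExactWFS (h : X.IsCompleteCotorsionPair A B) (hE : WeaklyIdempotentComplete E) :
    X.IsExactWFS (X.Infl A) (X.Defl B) where
  isWeakFactorizationSystem :=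
    { rlp := h.rlp_infl hE
      llp := h.llp_defl hE
      hasFactorization := ⟨fun f =>
        have ⟨V, i, p, hi, hp, fac⟩ := h.exists_factorization f
        ⟨{ Z := V, i := i, p := p, fac := fac, hi := hi, hp := hp }⟩⟩ }
  mem_left_iff f := by
    have := h.isClosedUnderIsomorphisms_left
    rw [fromZero_infl]
  mem_right_iff f := by
    have := h.isClosedUnderIsomorphisms_right
    rw [toZero_defl]

end IsCompleteCotorsionPair

namespace IsExactWFS

variable {L R : MorphismProperty E}

lemma extOrthogonal (h : X.IsExactWFS L R) {A B : E} (hA : fromZero L A) (hB : toZero R B) :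
    X.ExtOrthogonal A B := by
  intro M i p hp
  have := h.isWeakFactorizationSystem
  have := MorphismProperty.hasLiftingProperty_of_wfs _ p hA ((h.mem_right_iff p).2 (hp.defl hB))
  have sq : CommSq 0 (0 : (0 : E) ⟶ A) p (𝟙 A) := ⟨by simp⟩
  exact ⟨sq.lift, sq.fac_right⟩

lemma fromZero_of_forall_extOrthogonal (h : X.IsExactWFS L R) {A : E}
    (hA : ∀ B, toZero R B → X.ExtOrthogonal A B) : fromZero L A := by
  have := h.isWeakFactorizationSystem
  rw [fromZero, ← MorphismProperty.llp_eq_of_wfs L R]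
  intro Y Z p hp
  obtain ⟨K, k, hk, hK⟩ := defl_iff.1 ((h.mem_right_iff p).1 hp)
  exact (hA K hK).hasLiftingProperty (X.isConflation_zero_id A) hk

lemma toZero_of_forall_extOrthogonal (h : X.IsExactWFS L R) {B : E}
    (hB : ∀ A, fromZero L A → X.ExtOrthogonal A B) : toZero R B := by
  have := h.isWeakFactorizationSystem
  rw [toZero, ← MorphismProperty.rlp_eq_of_wfs L R]
  intro Y Z i hi
  obtain ⟨C, c, hc, hC⟩ := infl_iff.1 ((h.mem_left_iff i).1 hi)
  exact (hB C hC).hasLiftingProperty hc (X.isConflation_id_zero B)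

lemma isCompleteCotorsionPair (h : X.IsExactWFS L R) :
    X.IsCompleteCotorsionPair (fromZero L) (toZero R) := by
  have := h.isWeakFactorizationSystem
  refine ⟨?_, ?_, fun Y => ?_, fun Y => ?_⟩
  · ext A
    exact ⟨fun hA => leftPerp_iff.2 fun B hB => h.extOrthogonal hA hB,
      fun hA => h.fromZero_of_forall_extOrthogonal (leftPerp_iff.1 hA)⟩
  · ext B
    exact ⟨fun hB => h.toZero_of_forall_extOrthogonal (rightPerp_iff.1 hB),
      fun hB => rightPerp_iff.2 fun A hA => h.extOrthogonal hA hB⟩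
  · let d := MorphismProperty.factorizationData L R (0 : Y ⟶ (0 : E))
    obtain ⟨C, p, ⟨w, hp⟩, hC⟩ := infl_iff.1 ((h.mem_left_iff d.i).1 d.hi)
    have hd : d.p = 0 := (isZero_zero E).eq_of_tgt _ _
    exact ⟨_, _, _, _, w, hp, by rw [toZero, ← hd]; exact d.hp, hC⟩
  · let d := MorphismProperty.factorizationData L R (0 : (0 : E) ⟶ Y)
    obtain ⟨K, k, ⟨w, hk⟩, hK⟩ := defl_iff.1 ((h.mem_right_iff d.p).1 d.hp)
    have hd : d.i = 0 := (isZero_zero E).eq_of_src _ _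
    exact ⟨_, _, _, _, w, hk, hK, by rw [fromZero, ← hd]; exact d.hi⟩

lemma mem_left_iff_of_isConflation (h : X.IsExactWFS L R) {A B C : E} {i : A ⟶ B} {p : B ⟶ C}
    (hip : X.IsConflation i p) : L i ↔ fromZero L C := by
  have := h.isCompleteCotorsionPair.isClosedUnderIsomorphisms_left
  exact (h.mem_left_iff i).trans hip.infl_iff_cokernel

lemma mem_right_iff_of_isConflation (h : X.IsExactWFS L R) {A B C : E} {i : A ⟶ B} {p : B ⟶ C}
    (hip : X.IsConflation i p) : R p ↔ toZero R A := by
  have := h.isCompleteCotorsionPair.isClosedUnderIsomorphisms_right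
  exact (h.mem_right_iff p).trans hip.defl_iff_kernel

end IsExactWFS

end CotorsionPairs

section MappingCones

variable {W : ObjectProperty E}

namespace HasTwoOutOfThree

variable {A B C : E} {i : A ⟶ B} {p : B ⟶ C}

lemma iff_of_left (hW : X.HasTwoOutOfThree W) (h : X.IsConflation i p) (hA : W A) : W B ↔ W C :=
  ⟨hW.right _ h.2 hA, hW.middle _ h.2 hA⟩

lemma iff_of_middle (hW : X.HasTwoOutOfThree W) (h : X.IsConflation i p) (hB : W B) :
    W A ↔ W C :=
  ⟨fun hA => hW.right _ h.2 hA hB, hW.left _ h.2 hB⟩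

lemma prop_biprod (hW : X.HasTwoOutOfThree W) (hA : W A) (hB : W B) : W (A ⊞ B) :=
  (hW.iff_of_left (X.isConflation_inl_snd A B) hA).2 hB

lemma isClosedUnderIsomorphisms (hW : X.HasTwoOutOfThree W) : W.IsClosedUnderIsomorphisms where
  of_iso {A B} e hA := by
    have hAB : X.IsConflation e.hom (0 : B ⟶ (0 : E)) :=
      (X.isConflation_id_zero A).of_iso (Iso.refl A) e (Iso.refl 0) (by simp) (by simp)
    exact (hW.iff_of_left hAB hA).2 ((hW.iff_of_left (X.isConflation_id_zero A) hA).1 hA)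

lemma iff_of_isConflation_lift (hW : X.HasTwoOutOfThree W) {J J' D D' : E} {w : A ⟶ B}
    {j : A ⟶ J} {j' : A ⟶ J'} {q : B ⊞ J ⟶ D} {q' : B ⊞ J' ⟶ D'} (hJ : W J) (hJ' : W J')
    (hq : X.IsConflation (biprod.lift w j) q) (hq' : X.IsConflation (biprod.lift w j') q') :
    W D ↔ W D' := by
  -- Both cokernels are quotients, by `J'` and by `J`, of the cokernel of `A ⟶ J' ⊞ (B ⊞ J)`.
  obtain ⟨M, m, b, hm, hb⟩ := hq.exists_isConflation_lift j'
  obtain ⟨M', m', b', hm', hb'⟩ := hq'.exists_isConflation_lift j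
  let swap : J' ⊞ (B ⊞ J) ≅ J ⊞ (B ⊞ J') :=
    { hom := biprod.lift (biprod.snd ≫ biprod.snd)
        (biprod.lift (biprod.snd ≫ biprod.fst) biprod.fst)
      inv := biprod.lift (biprod.snd ≫ biprod.snd)
        (biprod.lift (biprod.snd ≫ biprod.fst) biprod.fst) }
  have hswap : biprod.lift j' (biprod.lift w j) ≫ swap.hom = biprod.lift j (biprod.lift w j') := by
    ext <;> simp [swap]
  obtain ⟨e, -⟩ := (hswap ▸ hm.comp_iso swap).exists_iso_cokernel hm'
  have := hW.isClosedUnderIsomorphisms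
  rw [← hW.iff_of_left hb hJ', ← hW.iff_of_left hb' hJ, W.prop_iff_of_iso e]

end HasTwoOutOfThree

/-- The morphisms `w : A ⟶ B` with a mapping cone in `W`, by which we mean the cokernel of an
inflation `(w, j) : A ⟶ B ⊞ J` with `J` in `W`. They are the weak equivalences attached to the
class `W` of trivial objects. -/
def hasConeIn (X : ExactStructure E) (W : ObjectProperty E) : MorphismProperty E :=
  fun A _ w => ∃ (J : E) (j : A ⟶ J), W J ∧ X.Infl W (biprod.lift w j)

/-- Every object is the source of an inflation with target in `W`. -/
def HasEmbeddingsInto (X : ExactStructure E) (W : ObjectProperty E) : Prop :=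
  ∀ A : E, ∃ (J C : E) (j : A ⟶ J) (p : J ⟶ C), W J ∧ X.IsConflation j p

namespace HasTwoOutOfThree

variable {A B C : E} {i : A ⟶ B} {p : B ⟶ C}

lemma hasConeIn_iff (hW : X.HasTwoOutOfThree W) {J D : E} {w : A ⟶ B} {j : A ⟶ J}
    {q : B ⊞ J ⟶ D} (hJ : W J) (hq : X.IsConflation (biprod.lift w j) q) :
    X.hasConeIn W w ↔ W D := by
  refine ⟨fun ⟨J', j', hJ', hw⟩ => ?_, fun hD => ⟨J, j, hJ, hq.infl hD⟩⟩
  obtain ⟨D', q', hq', hD'⟩ := infl_iff.1 hw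
  exact (hW.iff_of_isConflation_lift hJ hJ' hq hq').2 hD'

lemma hasConeIn_iff_cokernel (hW : X.HasTwoOutOfThree W) (hX : X.HasEmbeddingsInto W)
    (h : X.IsConflation i p) : X.hasConeIn W i ↔ W C := by
  obtain ⟨J, _, j, _, hJ, -⟩ := hX A
  obtain ⟨D, d, b, hd, hb, -⟩ := (X.isConflation_inr_fst B J).exists_cokernel_of_comp_deflation
    (f := biprod.lift i j) (by simpa using h)
  rw [hW.hasConeIn_iff hJ hd, hW.iff_of_left hb hJ]

lemma hasConeIn_iff_kernel (hW : X.HasTwoOutOfThree W) (hX : X.HasEmbeddingsInto W)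
    (h : X.IsConflation i p) : X.hasConeIn W p ↔ W A := by
  obtain ⟨J, _, j, _, hJ, hj⟩ := hX B
  obtain ⟨M, π, a, b, hπ, -, sq, -⟩ := h.exists_cokernel_comp hj
  rw [hW.hasConeIn_iff hJ (hj.lift_of_isPushout sq), hW.iff_of_middle hπ hJ]

lemma exists_isConflation_cones (hW : X.HasTwoOutOfThree W) (hX : X.HasEmbeddingsInto W)
    (f : A ⟶ B) (g : B ⟶ C) :
    ∃ (D M D' : E) (a : D ⟶ M) (b : M ⟶ D'), X.IsConflation a b ∧ (X.hasConeIn W f ↔ W D) ∧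
      (X.hasConeIn W (f ≫ g) ↔ W M) ∧ (X.hasConeIn W g ↔ W D') := by
  obtain ⟨J, _, j, _, hJ, hj⟩ := hX A
  obtain ⟨K, _, k, _, hK, hk⟩ := hX B
  obtain ⟨D, q, -, hq, -⟩ := hj.exists_isConflation_lift f
  obtain ⟨D', q', -, hq', -⟩ := hk.exists_isConflation_lift g
  obtain ⟨M, π, a, b, hπ, hab, -⟩ :=
    hq.exists_cokernel_comp ((hq'.map_id J).comp_iso (biprod.associator C K J))
  have hfg : biprod.lift f j ≫ biprod.map (biprod.lift g k) (𝟙 J) ≫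
      (biprod.associator C K J).hom = biprod.lift (f ≫ g) (biprod.lift (f ≫ k) j) := by
    ext <;> simp
  exact ⟨D, M, D', a, b, hab, hW.hasConeIn_iff hJ hq,
    hW.hasConeIn_iff (hW.prop_biprod hK hJ) (hfg ▸ hπ), hW.hasConeIn_iff hK hq'⟩

lemma hasConeIn_hasTwoOutOfThreeProperty (hW : X.HasTwoOutOfThree W)
    (hX : X.HasEmbeddingsInto W) : (X.hasConeIn W).HasTwoOutOfThreeProperty where
  comp_mem f g hf hg := by
    obtain ⟨D, M, D', a, b, h, hfD, hfgM, hgD'⟩ := hW.exists_isConflation_cones hX f g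
    exact hfgM.2 (hW.middle _ h.2 (hfD.1 hf) (hgD'.1 hg))
  of_postcomp f g hg hfg := by
    obtain ⟨D, M, D', a, b, h, hfD, hfgM, hgD'⟩ := hW.exists_isConflation_cones hX f g
    exact hfD.2 (hW.left _ h.2 (hfgM.1 hfg) (hgD'.1 hg))
  of_precomp f g hf hfg := by
    obtain ⟨D, M, D', a, b, h, hfD, hfgM, hgD'⟩ := hW.exists_isConflation_cones hX f g
    exact hgD'.2 (hW.right _ h.2 (hfD.1 hf) (hfgM.1 hfg))

end HasTwoOutOfThree

lemma IsConflation.nonempty_retract_cokernel {A B C A' B' C' : E} {i : A ⟶ B} {p : B ⟶ C}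
    {i' : A' ⟶ B'} {p' : B' ⟶ C'} (hp : X.IsConflation i p) (hp' : X.IsConflation i' p')
    (h : Retract B B') {s : A ⟶ A'} (hs : i ≫ h.i = s ≫ i') {r : A' ⟶ A}
    (hr : i' ≫ h.r = r ≫ i) : Nonempty (Retract C C') := by
  obtain ⟨t, ht⟩ := hp.exists_desc (h.i ≫ p') (by rw [reassoc_of% hs, hp'.zero, comp_zero])
  obtain ⟨u, hu⟩ := hp'.exists_desc (h.r ≫ p) (by rw [reassoc_of% hr, hp.zero, comp_zero])
  have := hp.epi
  refine ⟨⟨t, u, ?_⟩⟩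
  rw [← cancel_epi p, reassoc_of% ht, hu, h.retract_assoc, Category.comp_id]

lemma HasEmbeddingsInto.exists_retract (hX : X.HasEmbeddingsInto W) (hW : X.HasTwoOutOfThree W)
    {A A' : E} (h : Retract A A') :
    ∃ (J J' C C' : E) (j : A ⟶ J) (j' : A' ⟶ J') (p : J ⟶ C) (p' : J' ⟶ C') (hJ : Retract J J'),
      W J ∧ W J' ∧ X.IsConflation j p ∧ X.IsConflation j' p' ∧
        j ≫ hJ.i = h.i ≫ j' ∧ j' ≫ hJ.r = h.r ≫ j := by
  -- With `j₁ = (h.i ≫ k, j)`, the inflation `(h.r ≫ j₁, k)` of `A'` must be corrected to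
  -- `(h.r ≫ j₁, k - h.r ≫ h.i ≫ k)` to be compatible with `h.i`. The component `h.i ≫ k` of `j₁`
  -- makes this correction a shear automorphism.
  obtain ⟨J, _, j, _, hJ, hj⟩ := hX A
  obtain ⟨K, _, k, _, hK, hk⟩ := hX A'
  obtain ⟨C, p, -, hp, -⟩ := hj.exists_isConflation_lift (h.i ≫ k)
  obtain ⟨C', p', -, hp', -⟩ := hk.exists_isConflation_lift (h.r ≫ biprod.lift (h.i ≫ k) j)
  let shear := Biprod.unipotentUpper (-biprod.fst : K ⊞ J ⟶ K)
  refine ⟨K ⊞ J, (K ⊞ J) ⊞ K, C, C', _, _, p, _, ⟨biprod.inl, biprod.fst, by simp⟩,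
    hW.prop_biprod hK hJ, hW.prop_biprod (hW.prop_biprod hK hJ) hK, hp, hp'.comp_iso shear, ?_, ?_⟩
  · ext <;> simp [shear]
  · ext <;> simp [shear]

lemma HasTwoOutOfThree.hasConeIn_isStableUnderRetracts (hW : X.HasTwoOutOfThree W)
    (hX : X.HasEmbeddingsInto W) [W.IsStableUnderRetracts] :
    (X.hasConeIn W).IsStableUnderRetracts where
  of_retract {A B A' B'} f g h hg := by
    obtain ⟨J, J', _, _, j, j', _, _, r, hJ, hJ', hj, hj', hi, hr⟩ := hX.exists_retract hW h.left
    obtain ⟨D, q, -, hq, -⟩ := hj.exists_isConflation_lift f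
    obtain ⟨D', q', -, hq', -⟩ := hj'.exists_isConflation_lift g
    let hBJ : Retract (B ⊞ J) (B' ⊞ J') :=
      { i := biprod.map h.i.right r.i
        r := biprod.map h.r.right r.r
        retract := by ext <;> simp }
    obtain ⟨hD⟩ := hq.nonempty_retract_cokernel hq' hBJ (s := h.i.left) (r := h.r.left)
      (by ext <;> simp [hBJ, hi]) (by ext <;> simp [hBJ, hr])
    exact (hW.hasConeIn_iff hJ hq).2 (W.prop_of_retract hD ((hW.hasConeIn_iff hJ' hq').1 hg))

end MappingCones

section HoveyCorrespondence

namespace HoveyTriple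

variable (T : X.HoveyTriple)

instance : T.W.IsStableUnderRetracts := T.isStableUnderRetracts

instance : T.C.IsClosedUnderIsomorphisms :=
  T.isCompleteCotorsionPair_cof.isClosedUnderIsomorphisms_left

instance : T.W.IsClosedUnderIsomorphisms := T.hasTwoOutOfThree.isClosedUnderIsomorphisms

instance : T.F.IsClosedUnderIsomorphisms :=
  T.isCompleteCotorsionPair_fib.isClosedUnderIsomorphisms_right

lemma hasEmbeddingsInto : X.HasEmbeddingsInto T.W := fun Y => by
  obtain ⟨B, A, i, p, w, h, hB, -⟩ := T.isCompleteCotorsionPair_cof.exists_left_approx Y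
  exact ⟨B, A, i, p, hB.1, w, h⟩

lemma infl_inf_hasConeIn : X.Infl T.C ⊓ X.hasConeIn T.W = X.Infl (T.C ⊓ T.W) := by
  rw [infl_inf]
  ext A B f
  refine and_congr_right fun hf => ?_
  obtain ⟨_, _, h, -⟩ := infl_iff.1 hf
  rw [T.hasTwoOutOfThree.hasConeIn_iff_cokernel T.hasEmbeddingsInto h, h.infl_iff_cokernel]

lemma hasConeIn_inf_defl : X.hasConeIn T.W ⊓ X.Defl T.F = X.Defl (T.W ⊓ T.F) := by
  rw [defl_inf]
  ext A B f
  refine and_congr_left fun hf => ?_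
  obtain ⟨_, _, h, -⟩ := defl_iff.1 hf
  rw [T.hasTwoOutOfThree.hasConeIn_iff_kernel T.hasEmbeddingsInto h, h.defl_iff_kernel]

lemma fromZero_hasConeIn : fromZero (X.hasConeIn T.W) = T.W := by
  ext A
  exact T.hasTwoOutOfThree.hasConeIn_iff_cokernel T.hasEmbeddingsInto (X.isConflation_zero_id A)

/-- The exact model structure attached to a Hovey triple. Its weak equivalences are defined by
mapping cones rather than by the factorizations of the correspondence, for which the 2-out-of-3
property is not visible. -/
def toExactModelStructure (hE : WeaklyIdempotentComplete E) : X.ExactModelStructure where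
  cof := X.Infl T.C
  weq := X.hasConeIn T.W
  fib := X.Defl T.F
  weq_isStableUnderRetracts :=
    T.hasTwoOutOfThree.hasConeIn_isStableUnderRetracts T.hasEmbeddingsInto
  weq_hasTwoOutOfThreeProperty :=
    T.hasTwoOutOfThree.hasConeIn_hasTwoOutOfThreeProperty T.hasEmbeddingsInto
  isExactWFS_cof_trivialFib :=
    T.hasConeIn_inf_defl ▸ T.isCompleteCotorsionPair_cof.isExactWFS hE
  isExactWFS_trivialCof_fib :=
    T.infl_inf_hasConeIn ▸ T.isCompleteCotorsionPair_fib.isExactWFS hE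

end HoveyTriple

attribute [ext] HoveyTriple ExactModelStructure

namespace ExactModelStructure

variable (M : X.ExactModelStructure)

instance : M.weq.IsStableUnderRetracts := M.weq_isStableUnderRetracts

instance : M.weq.HasTwoOutOfThreeProperty := M.weq_hasTwoOutOfThreeProperty

instance : M.cof.IsWeakFactorizationSystem (M.weq ⊓ M.fib) :=
  M.isExactWFS_cof_trivialFib.isWeakFactorizationSystem

instance : (M.cof ⊓ M.weq).IsWeakFactorizationSystem M.fib :=
  M.isExactWFS_trivialCof_fib.isWeakFactorizationSystem

lemma weq_id (A : E) : M.weq (𝟙 A) := by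
  have hA : (M.cof ⊓ M.weq) (𝟙 A) := by
    rw [← MorphismProperty.llp_eq_of_wfs (M.cof ⊓ M.weq) M.fib]
    intro _ _ _ _
    infer_instance
  exact hA.2

variable {A B C : E} {i : A ⟶ B} {p : B ⟶ C}

lemma fromZero_weq_iff_of_weq {w : A ⟶ B} (hw : M.weq w) :
    fromZero M.weq A ↔ fromZero M.weq B := by
  rw [fromZero, fromZero, ← zero_comp (f := w)]
  exact (M.weq.postcomp_iff (W' := M.weq) _ _ hw).symm

lemma fromZero_weq_iff_toZero : fromZero M.weq A ↔ toZero M.weq A := by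
  have hA : M.weq ((0 : (0 : E) ⟶ A) ≫ (0 : A ⟶ (0 : E))) := by
    rw [(isZero_zero E).eq_of_src (_ ≫ _) (𝟙 _)]
    exact M.weq_id _
  exact ⟨fun h => M.weq.of_precomp _ _ h hA, fun h => M.weq.of_postcomp _ _ h hA⟩

lemma toZero_weq_inf_fib : toZero (M.weq ⊓ M.fib) = fromZero M.weq ⊓ toZero M.fib := by
  ext A
  exact and_congr_left fun _ => M.fromZero_weq_iff_toZero.symm

lemma weq_iff_of_cof (h : X.IsConflation i p) (hi : M.cof i) : M.weq i ↔ fromZero M.weq C := by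
  have hC := (M.isExactWFS_cof_trivialFib.mem_left_iff_of_isConflation h).1 hi
  have hiC := M.isExactWFS_trivialCof_fib.mem_left_iff_of_isConflation h
  exact ⟨fun hw => (hiC.1 ⟨hi, hw⟩).2, fun hw => (hiC.2 ⟨hC, hw⟩).2⟩

lemma weq_iff_of_fib (h : X.IsConflation i p) (hp : M.fib p) : M.weq p ↔ fromZero M.weq A := by
  have hA := (M.isExactWFS_trivialCof_fib.mem_right_iff_of_isConflation h).1 hp
  have hpA := M.isExactWFS_cof_trivialFib.mem_right_iff_of_isConflation h
  rw [fromZero_weq_iff_toZero]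
  exact ⟨fun hw => (hpA.1 ⟨hw, hp⟩).1, fun hw => (hpA.2 ⟨hw, hA⟩).1⟩

lemma weq_iff_fromZero_cokernel (h : X.IsConflation i p) : M.weq i ↔ fromZero M.weq C := by
  -- Factoring `i` as a cofibration followed by a trivial fibration replaces it by a cofibration
  -- whose cokernel is weakly equivalent to that of `i`.
  let d := MorphismProperty.factorizationData M.cof (M.weq ⊓ M.fib) i
  obtain ⟨K, k, hk, hK⟩ := defl_iff.1 ((M.isExactWFS_cof_trivialFib.mem_right_iff d.p).1 d.hp)
  obtain ⟨D, c, b, hc, hb, -⟩ := hk.exists_cokernel_of_comp_deflation (d.fac.symm ▸ h)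
  have hbw := (M.isExactWFS_cof_trivialFib.mem_right_iff b).2 (hb.defl hK)
  rw [← M.fromZero_weq_iff_of_weq hbw.1, ← M.weq_iff_of_cof hc d.hi]
  nth_rw 1 [← d.fac]
  exact M.weq.postcomp_iff (W' := M.weq) _ _ d.hp.1

lemma weq_iff_fromZero_kernel (h : X.IsConflation i p) : M.weq p ↔ fromZero M.weq A := by
  let d := MorphismProperty.factorizationData (M.cof ⊓ M.weq) M.fib p
  obtain ⟨K, k, hk, hK⟩ := infl_iff.1 ((M.isExactWFS_trivialCof_fib.mem_left_iff d.i).1 d.hi)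
  obtain ⟨D, c, b, hc, hb, -⟩ := hk.exists_kernel_of_inflation_comp (d.fac.symm ▸ h)
  have hbw := (M.isExactWFS_trivialCof_fib.mem_left_iff b).2 (hb.infl hK)
  rw [M.fromZero_weq_iff_of_weq hbw.2, ← M.weq_iff_of_fib hc d.hp]
  nth_rw 1 [← d.fac]
  exact M.weq.precomp_iff (W' := M.weq) _ _ d.hi.2

lemma hasTwoOutOfThree : X.HasTwoOutOfThree (fromZero M.weq) where
  left S hS h₂ h₃ := (M.fromZero_weq_iff_of_weq
    ((M.weq_iff_fromZero_cokernel ⟨S.zero, hS⟩).2 h₃)).2 h₂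
  middle S hS h₁ h₃ := (M.fromZero_weq_iff_of_weq
    ((M.weq_iff_fromZero_kernel ⟨S.zero, hS⟩).2 h₁)).2 h₃
  right S hS h₁ h₂ := (M.fromZero_weq_iff_of_weq
    ((M.weq_iff_fromZero_kernel ⟨S.zero, hS⟩).2 h₁)).1 h₂

/-- The Hovey triple of cofibrant, trivial and fibrant objects of an exact model structure. -/
def toHoveyTriple : X.HoveyTriple where
  C := fromZero M.cof
  W := fromZero M.weq
  F := toZero M.fib
  isStableUnderRetracts := ⟨fun {Y Z} h hZ =>
    M.weq.of_retract (f := (0 : (0 : E) ⟶ Y)) (g := (0 : (0 : E) ⟶ Z))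
      { i := Arrow.homMk (𝟙 _) h.i
        r := Arrow.homMk (𝟙 _) h.r } hZ⟩
  hasTwoOutOfThree := M.hasTwoOutOfThree
  isCompleteCotorsionPair_cof :=
    M.toZero_weq_inf_fib ▸ M.isExactWFS_cof_trivialFib.isCompleteCotorsionPair
  isCompleteCotorsionPair_fib := M.isExactWFS_trivialCof_fib.isCompleteCotorsionPair

lemma weq_iff_exists_factorization {Y Z : E} (w : Y ⟶ Z) :
    M.weq w ↔ ∃ (V : E) (wi : Y ⟶ V) (wd : V ⟶ Z),
      X.Infl (fromZero M.weq) wi ∧ X.Defl (fromZero M.weq) wd ∧ wi ≫ wd = w := by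
  constructor
  · intro hw
    let d := MorphismProperty.factorizationData M.cof (M.weq ⊓ M.fib) w
    obtain ⟨K, k, hk, hK⟩ := defl_iff.1 ((M.isExactWFS_cof_trivialFib.mem_right_iff d.p).1 d.hp)
    obtain ⟨C, c, hc, -⟩ := infl_iff.1 ((M.isExactWFS_cof_trivialFib.mem_left_iff d.i).1 d.hi)
    have hi : M.weq d.i := M.weq.of_postcomp _ d.p d.hp.1 (by rwa [d.fac])
    exact ⟨d.Z, d.i, d.p, hc.infl ((M.weq_iff_fromZero_cokernel hc).1 hi),
      hk.defl (M.fromZero_weq_iff_toZero.2 hK.1), d.fac⟩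
  · rintro ⟨V, i, p, hi, hp, rfl⟩
    obtain ⟨K, k, hk, hK⟩ := defl_iff.1 hp
    obtain ⟨C, c, hc, hC⟩ := infl_iff.1 hi
    exact M.weq.comp_mem _ _ ((M.weq_iff_fromZero_cokernel hc).2 hC)
      ((M.weq_iff_fromZero_kernel hk).2 hK)

end ExactModelStructure

lemma HoveyTriple.hasConeIn_iff_exists_factorization (T : X.HoveyTriple)
    (hE : WeaklyIdempotentComplete E) {Y Z : E} (w : Y ⟶ Z) :
    X.hasConeIn T.W w ↔ ∃ (V : E) (wi : Y ⟶ V) (wd : V ⟶ Z),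
      X.Infl T.W wi ∧ X.Defl T.W wd ∧ wi ≫ wd = w := by
  have h := (T.toExactModelStructure hE).weq_iff_exists_factorization w
  rwa [toExactModelStructure, fromZero_hasConeIn] at h

/-- Hovey's correspondence. -/
def hoveyEquiv (X : ExactStructure E) (hE : WeaklyIdempotentComplete E) :
    X.HoveyTriple ≃ X.ExactModelStructure where
  toFun T := T.toExactModelStructure hE
  invFun M := M.toHoveyTriple
  left_inv T := HoveyTriple.ext fromZero_infl T.fromZero_hasConeIn toZero_defl
  right_inv M := by
    ext A B f
    · exact (M.isExactWFS_cof_trivialFib.mem_left_iff f).symm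
    · exact (M.toHoveyTriple.hasConeIn_iff_exists_factorization hE f).trans
        (M.weq_iff_exists_factorization f).symm
    · exact (M.isExactWFS_trivialCof_fib.mem_right_iff f).symm

end HoveyCorrespondence

end ExactStructure

theorem mainTheorem7 {E : Type u} [Category.{v} E] [Preadditive E] [HasZeroObject E]
    [HasBinaryBiproducts E] (X : ExactStructure E) (hE : WeaklyIdempotentComplete E) :
    ∃ e : X.HoveyTriple ≃ X.ExactModelStructure,
      (∀ T : X.HoveyTriple,
        (∀ ⦃Y Z : E⦄ (c : Y ⟶ Z), (e T).cof c ↔ X.Infl T.C c) ∧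
        (∀ ⦃Y Z : E⦄ (w : Y ⟶ Z), (e T).weq w ↔
          ∃ (V : E) (wi : Y ⟶ V) (wd : V ⟶ Z), X.Infl T.W wi ∧ X.Defl T.W wd ∧ wi ≫ wd = w) ∧
        (∀ ⦃Y Z : E⦄ (f : Y ⟶ Z), (e T).fib f ↔ X.Defl T.F f)) ∧
      (∀ M : X.ExactModelStructure,
        (∀ A : E, (e.symm M).C A ↔ M.cof (0 : (0 : E) ⟶ A)) ∧
        (∀ A : E, (e.symm M).W A ↔ M.weq (0 : (0 : E) ⟶ A)) ∧
        (∀ A : E, (e.symm M).F A ↔ M.fib (0 : A ⟶ (0 : E)))) :=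
  ⟨X.hoveyEquiv hE,
    fun T => ⟨fun _ _ _ => Iff.rfl, fun _ _ w => T.hasConeIn_iff_exists_factorization hE w,
      fun _ _ _ => Iff.rfl⟩,
    fun _ => ⟨fun _ => Iff.rfl, fun _ => Iff.rfl, fun _ => Iff.rfl⟩⟩
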